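/- Let $(X,d)$ be a locally compact metric space of positive dimension, i.e. for some $x\in X$ and some open set $U\ni x$ there is no $V\subseteq U$ with $x\in V$ that is both open and closed in $X$. For $A,B\subseteq X$, say that $A$ is continuously reducible to $B$ if $A=f^{-1}[B]$ for some continuous map $f\colon X\to X$, and that $A$, $B$ are incomparable if neither is continuously reducible to the other. Then there is an explicitly definable injective map $I\mapsto D_I$ from the subsets of the Cantor space $2^{\mathbb{N}}$ (sets of reals) to the subsets of $X$ such that $D_I$ and $D_J$ are incomparable for all distinct $I,J\subseteq 2^{\mathbb{N}}$. Here "explicitly definable" means that there are a homeomorphic embedding $h\colon 2^{\mathbb{N}}\to X$ (necessarily with closed range) and a Borel set $D\subseteq X$ disjoint from $h[2^{\mathbb{N}}]$ such that $D_I=h[I]\cup D$ for all $I\subseteq 2^{\mathbb{N}}$. -/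

import Mathlib

/-- `A` is continuously reducible to `B` in the space `X`: `A` is the preimage of `B` under some
continuous map from `X` to itself. -/
def ContinuouslyReducible {X : Type*} [TopologicalSpace X] (A B : Set X) : Prop :=
  ∃ f : X → X, Continuous f ∧ A = f ⁻¹' B

/-- `A` and `B` are incomparable: neither is continuously reducible to the other. -/
def ContinuouslyIncomparable {X : Type*} [TopologicalSpace X] (A B : Set X) : Prop :=
  ¬ (ContinuouslyReducible A B ∨ ContinuouslyReducible B A)

/-- The space `X` has (small inductive) dimension `0`: every open set that contains a point `x`
has a subset that contains `x` and is both open and closed in `X`. -/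
def HasDimensionZero (X : Type*) [TopologicalSpace X] : Prop :=
  ∀ x : X, ∀ U : Set X, IsOpen U → x ∈ U → ∃ V : Set X, V ⊆ U ∧ x ∈ V ∧ IsClopen V

/-- The space `X` has positive dimension if it does not have dimension `0`. -/
def HasPositiveDimension (X : Type*) [TopologicalSpace X] : Prop :=
  ¬ HasDimensionZero X

/-- A map from sets of reals (subsets of the Cantor space) to subsets of `X` is explicitly
definable if its value at `I` is the union of a fixed Borel set `D` and the copy `h '' I` of `I`
inside a fixed copy of the Cantor space in `X` that is disjoint from `D`. Thus `x ∈ Φ I` holds iff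
`x ∈ D`, or `x = h a` for some `a ∈ I`: a Borel definition, uniform in `I`, in which `I` occurs
only as a predicate. In particular `I = h ⁻¹' (Φ I)`, so `Φ I` is at least as complex as `I`. -/
def IsExplicitlyDefinable {X : Type*} [TopologicalSpace X]
    (Φ : Set (ℕ → Bool) → Set X) : Prop :=
  ∃ (h : (ℕ → Bool) → X) (D : Set X),
    Topology.IsClosedEmbedding h ∧ @MeasurableSet X (borel X) D ∧ Disjoint (Set.range h) D ∧
      ∀ I : Set (ℕ → Bool), Φ I = h '' I ∪ D

open Set Filter Topology Metric

/-! Positive dimension and local compactness yield a nondegenerate continuum `C`. A Cantor scheme of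
balls centred in `C` is built, each ball also containing a pole in `C` to which concentric shells
shrink. The level peaks at an integer height in the middle of each shell. The core consists of the
poles and the branch limits `h[2^ℕ]`; `D` is the set of points off the core whose rounded-up level
(rank) is even. Heights are constant around a pole, differ from pole to pole, and are unbounded
along branches.

If `f` reduces one `D_I` to another, the ranks of `x` and `f x` have equal parity when both points
avoid the core. Ranks jump locally by 0 or 1 only, so equal parity forces the two ranks to jump
together, and their difference is locally constant (`eventually_shift`). On a continuum around a
pole, connectedness then shows that the pole, and no other point, is sent into the core
(`f_p_mem_core`, `f_notMem_core`), and that ranks are preserved elsewhere (`rank_f`). Hence the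
image of a pole is neither surrounded by higher shells nor a pole with lower ones, so it is the same
pole (`map_pole`). Poles accumulate at every branch limit, so `f` fixes `h[2^ℕ]` pointwise and `I =
J`. -/

/-- A family of disjoint spherical shells `radius j / 2 < dist x (center j) < radius j` that
accumulate only at the closed set `core`, with a function `level` that rises from `1 / 2` at both
ends of a shell to the integer `height j` on its middle sphere. -/
structure ShellSystem (X : Type*) [MetricSpace X] where
  Index : Type
  center : Index → X
  radius : Index → ℝ
  height : Index → ℤ
  core : Set X
  level : X → ℝ
  radius_pos : ∀ j, 0 < radius j
  five_le_height : ∀ j, 5 ≤ height j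
  isClosed_core : IsClosed core
  continuousAt_level : ∀ x ∉ core, ContinuousAt level x
  half_le_level : ∀ x, 1 / 2 ≤ level x
  level_peak : ∀ j x, dist x (center j) = 3 / 4 * radius j → level x = height j
  level_outer : ∀ j x, dist x (center j) = radius j → level x = 1 / 2
  level_inner : ∀ j x, dist x (center j) = radius j / 2 → level x = 1 / 2
  notMem_core : ∀ j x, radius j / 2 ≤ dist x (center j) → dist x (center j) ≤ radius j → x ∉ core
  exists_shell : ∀ x, 1 / 2 < level x →
    ∃ j, radius j / 2 < dist x (center j) ∧ dist x (center j) < radius j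
  exists_small : ∀ b ∈ core, ∀ V ∈ 𝓝 b,
    ∃ j, dist b (center j) < 3 / 4 * radius j ∧ closedBall (center j) (radius j) ⊆ V

/-! ### Ranks and poles of a shell system. -/

namespace ShellSystem

variable {X : Type*} [MetricSpace X] (S : ShellSystem X)

/-- The level of a point, rounded up to an integer. -/
noncomputable def rank (x : X) : ℤ := ⌈S.level x⌉

theorem one_le_rank (x : X) : 1 ≤ S.rank x := by
  have := S.half_le_level x
  have h : 0 < S.rank x := Int.ceil_pos.2 (by linarith)
  omega

theorem rank_eq_of_level_eq {x : X} {n : ℤ} (h : S.level x = n) : S.rank x = n := by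
  rw [rank, h, Int.ceil_intCast]

theorem rank_eq_one_of_level_eq_half {x : X} (h : S.level x = 1 / 2) : S.rank x = 1 := by
  rw [rank, h, Int.ceil_eq_iff]; norm_num

theorem half_lt_level {x : X} (h : 2 ≤ S.rank x) : 1 / 2 < S.level x := by
  have h1 : (1 : ℤ) < S.rank x := by omega
  have := Int.lt_ceil.1 h1
  push_cast at this
  linarith

/-- Rounding up cannot drop under a small perturbation, and it rises by at most one. This
one-sidedness is what makes `Probe.shift` locally constant. -/
theorem eventually_rank {x : X} (hx : x ∉ S.core) :
    ∀ᶠ y in 𝓝 x, S.rank y = S.rank x ∨ S.rank y = S.rank x + 1 := by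
  have h1 : (S.rank x : ℝ) - 1 < S.level x := by
    have := Int.ceil_lt_add_one (S.level x)
    simp only [rank]; linarith
  have h2 : S.level x < S.rank x + 1 := by
    have := Int.le_ceil (S.level x)
    simp only [rank]; linarith
  filter_upwards [(S.continuousAt_level x hx).eventually (lt_mem_nhds h1),
    (S.continuousAt_level x hx).eventually (gt_mem_nhds h2)] with y hy1 hy2
  have a1 : S.rank x - 1 < S.rank y := Int.lt_ceil.2 (by push_cast; exact hy1)
  have a2 : S.rank y ≤ S.rank x + 1 := Int.ceil_le.2 (by push_cast; exact hy2.le)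
  omega

/-- `c` is an isolated point of the core around which shells of height `L` are nested, and no
higher level occurs at distance at most `R` from `c`. -/
structure IsPole (c : X) (R : ℝ) (L : ℤ) : Prop where
  mem_core : c ∈ S.core
  radius_pos : 0 < R
  notMem_core : ∀ x, x ≠ c → dist x c ≤ R → x ∉ S.core
  rank_le : ∀ x, x ≠ c → dist x c ≤ R → S.rank x ≤ L
  exists_shell : ∀ ε > 0, ∃ j, S.center j = c ∧ S.height j = L ∧ S.radius j < ε ∧ S.radius j < R

variable {S}

/-- If the integer level along `φ` differs from a locally constant function by one of two
consecutive values, then the middle sphere of a shell can be modified to a sphere that `φ`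
avoids. -/
theorem isClopen_inside {Y : Type*} [TopologicalSpace Y] {φ : Y → X} (hφ : Continuous φ)
    (j : S.Index) (t : Y → ℤ) (i : ℤ) {M : Set Y} (hM : IsClosed M)
    (hMn : ∀ y ∈ M, dist (φ y) (S.center j) ≤ S.radius j → M ∈ 𝓝 y)
    (ht : ∀ y ∈ M, 3 / 4 * S.radius j ≤ dist (φ y) (S.center j) →
      dist (φ y) (S.center j) ≤ S.radius j → ∀ᶠ z in 𝓝 y, t z = t y)
    (hv : ∀ y ∈ M, 3 / 4 * S.radius j ≤ dist (φ y) (S.center j) →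
      dist (φ y) (S.center j) ≤ S.radius j →
      S.rank (φ y) - t y = i ∨ S.rank (φ y) - t y = i + 1) :
    IsClopen {y | y ∈ M ∧ (dist (φ y) (S.center j) < 3 / 4 * S.radius j ∨
      dist (φ y) (S.center j) < S.radius j ∧
        (S.height j - t y = i ∨ S.height j - t y = i + 1))} := by
  have hr := S.radius_pos j
  have hA := S.five_le_height j
  have hd : Continuous fun y => dist (φ y) (S.center j) := hφ.dist continuous_const
  constructor
  · rw [← isOpen_compl_iff, isOpen_iff_mem_nhds]
    intro y hy
    by_cases hyM : y ∈ M
    · simp only [mem_compl_iff, mem_ofPred_eq, hyM, true_and, not_or, not_and, not_lt] at hy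
      obtain ⟨h1, h2⟩ := hy
      rcases lt_or_ge (S.radius j) (dist (φ y) (S.center j)) with h3 | h3
      · filter_upwards [hd.continuousAt.eventually (lt_mem_nhds h3)] with z hz hz'
        rcases hz'.2 with h | h <;> linarith [h, hz]
      · have hvy := hv y hyM h1 h3
        have hne : dist (φ y) (S.center j) ≠ S.radius j → dist (φ y) (S.center j) <
          S.radius j := fun h => lt_of_le_of_ne h3 h
        by_cases ho : dist (φ y) (S.center j) = S.radius j
        -- On the outer sphere the rank is 1, far below the height, so `1 - t y` and `height - t y`
        -- cannot both lie in `{i, i + 1}`.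
        · have hf := S.rank_eq_one_of_level_eq_half (S.level_outer j _ ho)
          have h4 : 3 / 4 * S.radius j < dist (φ y) (S.center j) := by rw [ho]; linarith
          filter_upwards [hd.continuousAt.eventually (lt_mem_nhds h4), ht y hyM h1 h3]
            with z hz hz1 hz'
          rcases hz'.2 with h | h
          · exact absurd h (by simpa using hz.le)
          · rw [hz1] at h
            omega
        · have h2' := h2 (hne ho)
          have h4 : 3 / 4 * S.radius j < dist (φ y) (S.center j) := by
            -- On the middle sphere the rank is the height, so `hv` itself gives the second
            -- alternative of the set: no boundary arises there.
            refine lt_of_le_of_ne h1 fun h => (not_or.2 h2') ?_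
            have := S.rank_eq_of_level_eq (S.level_peak j _ h.symm)
            rwa [this] at hvy
          filter_upwards [hd.continuousAt.eventually (lt_mem_nhds h4), ht y hyM h1 h3]
            with z hz hz1 hz'
          rcases hz'.2 with h | h
          · exact absurd h (by simpa using hz.le)
          · rw [hz1] at h
            exact (not_or.2 h2') h.2
    · filter_upwards [hM.isOpen_compl.mem_nhds hyM] with z hz hz'
      exact hz hz'.1
  · rw [isOpen_iff_mem_nhds]
    rintro y ⟨hyM, hy⟩
    rcases lt_or_ge (dist (φ y) (S.center j)) (3 / 4 * S.radius j) with h1 | h1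
    · filter_upwards [hMn y hyM (by linarith), hd.continuousAt.eventually (gt_mem_nhds h1)]
        with z hz hz1
      exact ⟨hz, Or.inl hz1⟩
    · rcases hy with hy | ⟨h2, h3⟩
      · exact absurd hy (by simpa using h1)
      · filter_upwards [hMn y hyM h2.le, hd.continuousAt.eventually (gt_mem_nhds h2),
          ht y hyM h1 h2.le] with z hz hz1 hz2
        exact ⟨hz, Or.inr ⟨hz1, by rwa [hz2]⟩⟩

/-! ### Rigidity of reductions near a pole. -/

/-- A continuous map `f` on a continuum around a pole, given together with the inclusion `g`,
such that `g` and `f` pull back two sets with prescribed parity off the core to the same set. -/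
structure Probe (S : ShellSystem X) (c : X) (R : ℝ) (L : ℤ) (Y : Type*)
    [TopologicalSpace Y] where
  isPole : S.IsPole c R L
  g : Y → X
  f : Y → X
  p : Y
  isInducing_g : IsInducing g
  continuous_f : Continuous f
  g_p : g p = c
  g_ne : ∀ y, y ≠ p → g y ≠ c
  dist_le : ∀ y, dist (g y) c ≤ R
  exists_dist_eq : ∃ y, dist (g y) c = R
  source : Set X
  target : Set X
  mem_source : ∀ x ∉ S.core, x ∈ source ↔ Even (S.rank x)
  mem_target : ∀ x ∉ S.core, x ∈ target ↔ Even (S.rank x)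
  mem_iff : ∀ y, g y ∈ source ↔ f y ∈ target

namespace Probe

theorem continuous_g {c : X} {R : ℝ} {L : ℤ} {Y : Type*} [TopologicalSpace Y]
    (P : Probe S c R L Y) : Continuous P.g :=
  P.isInducing_g.continuous

variable {c : X} {R : ℝ} {L : ℤ} {Y : Type*} [TopologicalSpace Y] (P : Probe S c R L Y)
include P

theorem g_notMem {y : Y} (hy : y ≠ P.p) : P.g y ∉ S.core :=
  P.isPole.notMem_core _ (P.g_ne y hy) (P.dist_le y)

theorem ne_p_of_notMem {y : Y} (hy : P.g y ∉ S.core) : y ≠ P.p := by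
  rintro rfl
  exact hy (by rw [P.g_p]; exact P.isPole.mem_core)

theorem rank_g_le {y : Y} (hy : y ≠ P.p) : S.rank (P.g y) ≤ L :=
  P.isPole.rank_le _ (P.g_ne y hy) (P.dist_le y)


theorem even_rank_iff {y : Y} (hy : y ≠ P.p) (hf : P.f y ∉ S.core) :
    Even (S.rank (P.f y)) ↔ Even (S.rank (P.g y)) := by
  rw [← P.mem_source _ (P.g_notMem hy), ← P.mem_target _ hf, P.mem_iff]

/-- The difference of the ranks of the image point and of the given point. -/
noncomputable def shift (y : Y) : ℤ := S.rank (P.f y) - S.rank (P.g y)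

theorem eventually_ne {y : Y} (hy : y ≠ P.p) : ∀ᶠ z in 𝓝 y, z ≠ P.p := by
  filter_upwards [P.continuous_g.continuousAt.eventually
    (S.isClosed_core.isOpen_compl.mem_nhds (P.g_notMem hy))] with z hz
  exact P.ne_p_of_notMem hz

/-- Both ranks change by 0 or 1 nearby and agree in parity before and after, so they change
together. -/
theorem eventually_shift {y : Y} (hy : y ≠ P.p) (hf : P.f y ∉ S.core) :
    ∀ᶠ z in 𝓝 y, P.shift z = P.shift y := by
  filter_upwards [P.eventually_ne hy,
    P.continuous_f.continuousAt.eventually (S.isClosed_core.isOpen_compl.mem_nhds hf),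
    P.continuous_g.continuousAt.eventually (S.eventually_rank (P.g_notMem hy)),
    P.continuous_f.continuousAt.eventually (S.eventually_rank hf)] with z h1 h2 h3 h4
  have a := P.even_rank_iff hy hf
  have b := P.even_rank_iff h1 h2
  simp only [shift]
  rcases h3 with h3 | h3 <;> rcases h4 with h4 | h4 <;> rw [h3, h4] at b ⊢ <;>
    (try simp only [Int.even_add_one] at b) <;> first | omega | (exfalso; tauto)

variable [PreconnectedSpace Y]

theorem exists_dist_eq_of_le {r : ℝ} (h0 : 0 ≤ r) (h1 : r ≤ R) : ∃ y, dist (P.g y) c = r := by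
  obtain ⟨z, hz⟩ := P.exists_dist_eq
  have := mem_range_of_exists_le_of_exists_ge (f := fun y => dist (P.g y) c) (c := r)
    (P.continuous_g.dist continuous_const) ⟨P.p, by simpa [P.g_p] using h0⟩ ⟨z, by simp [hz, h1]⟩
  exact this

/-- The image of the pole lies in the core: otherwise the image of a neighbourhood of the pole
takes only two ranks, and then the continuum cannot cross the shells around the pole. -/
theorem f_p_mem_core : P.f P.p ∈ S.core := by
  by_contra hb
  have h1 : ∀ᶠ y in 𝓝 P.p, P.f y ∉ S.core ∧
      (S.rank (P.f y) = S.rank (P.f P.p) ∨ S.rank (P.f y) = S.rank (P.f P.p) + 1) :=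
    (P.continuous_f.continuousAt.eventually (S.isClosed_core.isOpen_compl.mem_nhds hb)).and
      (P.continuous_f.continuousAt.eventually (S.eventually_rank hb))
  rw [P.isInducing_g.nhds_eq_comap, P.g_p, eventually_comap,
    Metric.eventually_nhds_iff] at h1
  obtain ⟨ε, hε, h1⟩ := h1
  obtain ⟨j, hc, -, hjε, hjR⟩ := P.isPole.exists_shell ε hε
  have hr := S.radius_pos j
  have key : ∀ y, 3 / 4 * S.radius j ≤ dist (P.g y) (S.center j) →
      dist (P.g y) (S.center j) ≤ S.radius j → y ≠ P.p ∧ P.f y ∉ S.core ∧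
      (S.rank (P.f y) = S.rank (P.f P.p) ∨ S.rank (P.f y) = S.rank (P.f P.p) + 1) := by
    intro y h2 h3
    rw [hc] at h2 h3
    refine ⟨?_, h1 (h3.trans_lt hjε) y rfl⟩
    rintro rfl
    rw [P.g_p, dist_self] at h2
    linarith
  -- With `t = -shift`, the difference `rank (g y) - t y` is the rank of `f y`, which takes two
  -- consecutive values near the pole.
  have hcl := isClopen_inside P.continuous_g j (fun y => -P.shift y) (S.rank (P.f P.p))
    isClosed_univ (fun _ _ _ => univ_mem)
    (fun y _ h2 h3 => by
      filter_upwards [P.eventually_shift (key y h2 h3).1 (key y h2 h3).2.1] with z hz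
      rw [hz])
    (fun y _ h2 h3 => by
      have := (key y h2 h3).2.2
      simp only [shift]
      omega)
  have huniv := hcl.eq_univ ⟨P.p, mem_univ _, Or.inl (by
    rw [P.g_p, hc, dist_self]; positivity)⟩
  obtain ⟨z, hz⟩ := P.exists_dist_eq
  have hz' := huniv.symm ▸ mem_univ z
  rcases hz'.2 with h | h
  · rw [hc, hz] at h; linarith
  · rw [hc, hz] at h; linarith [h.1]

/-- Only the pole is mapped into the core. -/
theorem f_notMem_core [CompactSpace Y] {x : Y} (hx : x ≠ P.p) : P.f x ∉ S.core := by
  intro hb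
  have hxc : 0 < dist (P.g x) c := dist_pos.2 (P.g_ne x hx)
  have hL : 5 ≤ L := by
    obtain ⟨j, -, h, -⟩ := P.isPole.exists_shell 1 one_pos
    exact h ▸ S.five_le_height j
  set i := S.rank (P.g x) with hi
  have hi1 : 1 ≤ i := S.one_le_rank _
  -- A sphere around the pole that misses the level band of `x`: a middle sphere if `i < L`, as its
  -- level `L` is too high, otherwise an outer sphere, whose level 1/2 is too low.
  obtain ⟨δ, hδ0, hδx, hδ⟩ : ∃ δ > 0, δ < dist (P.g x) c ∧ ∀ y, dist (P.g y) c = δ →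
      ¬ ((i : ℝ) - 1 ≤ S.level (P.g y) ∧ S.level (P.g y) ≤ i + 1 / 2) := by
    obtain ⟨j, hc, hh, hjx, -⟩ := P.isPole.exists_shell _ hxc
    have hr := S.radius_pos j
    by_cases hiL : i < L
    · refine ⟨3 / 4 * S.radius j, by positivity, by linarith, fun y hy h => ?_⟩
      rw [S.level_peak j _ (by rwa [hc]), hh] at h
      have : (i : ℝ) + 1 ≤ L := by exact_mod_cast hiL
      linarith [h.2]
    · refine ⟨S.radius j, hr, hjx, fun y hy h => ?_⟩
      rw [S.level_outer j _ (by rwa [hc])] at h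
      have : (5 : ℝ) ≤ i := by exact_mod_cast (by omega : (5 : ℤ) ≤ i)
      linarith [h.1]
  have hdist : Continuous fun y => dist (P.g y) c := P.continuous_g.dist continuous_const
  have hne : ∀ y, δ ≤ dist (P.g y) c → y ≠ P.p := by
    rintro y hy rfl
    rw [P.g_p, dist_self] at hy
    linarith
  have hlev : ∀ y, δ ≤ dist (P.g y) c → ContinuousAt (fun y => S.level (P.g y)) y := fun y hy =>
    ContinuousAt.comp (g := S.level) (S.continuousAt_level _ (P.g_notMem (hne y hy)))
      P.continuous_g.continuousAt
  have hclosed : ∀ T : Set ℝ, IsClosed T →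
      IsClosed {y | δ ≤ dist (P.g y) c ∧ S.level (P.g y) ∈ T} := by
    intro T hT
    have : ContinuousOn (fun y => S.level (P.g y)) {y | δ ≤ dist (P.g y) c} := fun y hy =>
      (hlev y hy).continuousWithinAt
    exact this.preimage_isClosed_of_isClosed (isClosed_le continuous_const hdist) hT
  -- The upper end `i + 1/2` leaves room when the level at `x` is exactly `i`. On the edges `E` of
  -- the band the rank is `i - 1` or `i + 1`, of parity opposite to `i`, so no point of `E` shares
  -- its image with `x`.
  set M := {y | δ ≤ dist (P.g y) c ∧ S.level (P.g y) ∈ Icc ((i : ℝ) - 1) (i + 1 / 2)} with hM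
  set E := {y | δ ≤ dist (P.g y) c ∧ S.level (P.g y) ∈ ({(i : ℝ) - 1, (i : ℝ) + 1 / 2} : Set ℝ)}
    with hE
  have hMc : IsClosed M := hclosed _ isClosed_Icc
  have hEc : IsClosed E := hclosed _ (Set.toFinite _).isClosed
  have hrankE : ∀ y ∈ E, S.rank (P.g y) = i - 1 ∨ S.rank (P.g y) = i + 1 := by
    rintro y ⟨-, h | h⟩
    · left
      exact S.rank_eq_of_level_eq (by rw [h]; push_cast; ring)
    · right
      rw [rank, h, Int.ceil_eq_iff]
      push_cast
      constructor <;> linarith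
  have hbE : P.f x ∉ P.f '' E := by
    rintro ⟨y, hy, hyx⟩
    have h1 := P.mem_iff y
    rw [hyx, ← P.mem_iff x, P.mem_source _ (P.g_notMem hx),
      P.mem_source _ (P.g_notMem (hne y hy.1)), ← hi] at h1
    rcases hrankE y hy with h | h <;> rw [h] at h1
    · rw [Int.even_sub_one] at h1; tauto
    · rw [Int.even_add_one] at h1; tauto
  have hV : (P.f '' E)ᶜ ∈ 𝓝 (P.f x) :=
    (hEc.isCompact.image P.continuous_f).isClosed.isOpen_compl.mem_nhds hbE
  obtain ⟨j, hj, hjV⟩ := S.exists_small _ hb _ hV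
  have hr := S.radius_pos j
  have hin : ∀ y ∈ M, dist (P.f y) (S.center j) ≤ S.radius j →
      δ < dist (P.g y) c ∧ S.level (P.g y) ∈ Ioo ((i : ℝ) - 1) (i + 1 / 2) := by
    intro y hy h
    have hyE : y ∉ E := fun h' => hjV (mem_closedBall.2 h) ⟨y, h', rfl⟩
    refine ⟨lt_of_le_of_ne hy.1 fun h' => hδ y h'.symm hy.2, lt_of_le_of_ne hy.2.1 fun h' => ?_,
      lt_of_le_of_ne hy.2.2 fun h' => ?_⟩
    · exact hyE ⟨hy.1, Or.inl h'.symm⟩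
    · exact hyE ⟨hy.1, Or.inr h'⟩
  -- The roles are swapped: along `f` with `t = shift`, the difference is the rank of `g y`, which
  -- is `i` or `i + 1` in the open band.
  have hcl := isClopen_inside P.continuous_f j P.shift i hMc
    (fun y hy h => by
      obtain ⟨h1, h2⟩ := hin y hy h
      filter_upwards [hdist.continuousAt.eventually (lt_mem_nhds h1),
        (hlev y hy.1).eventually (Ioo_mem_nhds h2.1 h2.2)] with z hz1 hz2
      exact ⟨hz1.le, Ioo_subset_Icc_self hz2⟩)
    (fun y hy h1 h2 => P.eventually_shift (hne y hy.1) (S.notMem_core j _ (by linarith) h2))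
    (fun y hy h1 h2 => by
      obtain ⟨h3, h4⟩ := (hin y hy h2).2
      have a1 : i - 1 < S.rank (P.g y) := Int.lt_ceil.2 (by push_cast; exact h3)
      have a2 : S.rank (P.g y) ≤ i + 1 := Int.ceil_le.2 (by push_cast; linarith)
      simp only [shift]
      omega)
  have hxM : x ∈ M := by
    have a1 : S.level (P.g x) ≤ i := Int.le_ceil _
    have a2 : (i : ℝ) < S.level (P.g x) + 1 := Int.ceil_lt_add_one _
    exact ⟨hδx.le, by linarith, by linarith⟩
  have huniv := hcl.eq_univ ⟨x, hxM, Or.inl hj⟩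
  have hp := huniv.symm ▸ mem_univ P.p
  exact hne _ hp.1.1 rfl

/-- The bounding spheres of a shell have rank 1, so points of shift `s` cannot cross them; the
closed shell misses the core and hence the image of the pole. -/
theorem isClopen_confined [CompactSpace Y] {φ : Y → X} (hφ : Continuous φ)
    (hp : φ P.p ∈ S.core) (j : S.Index) (s : ℤ)
    (hs : ∀ y, y ≠ P.p → P.shift y = s → 2 ≤ S.rank (φ y)) :
    IsClopen {y | P.shift y = s ∧ S.radius j / 2 < dist (φ y) (S.center j) ∧
      dist (φ y) (S.center j) < S.radius j} := by
  have hr := S.radius_pos j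
  have hd : Continuous fun y => dist (φ y) (S.center j) := hφ.dist continuous_const
  have hne : ∀ y, S.radius j / 2 ≤ dist (φ y) (S.center j) →
      dist (φ y) (S.center j) ≤ S.radius j → y ≠ P.p := by
    rintro y h1 h2 rfl
    exact S.notMem_core j _ h1 h2 hp
  constructor
  · rw [← isOpen_compl_iff, isOpen_iff_mem_nhds]
    intro y hy
    by_cases h1 : S.radius j / 2 ≤ dist (φ y) (S.center j)
    · by_cases h2 : dist (φ y) (S.center j) ≤ S.radius j
      · have hyp := hne y h1 h2
        by_cases h3 : P.shift y = s
        · exfalso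
          have h4 := S.half_lt_level (hs y hyp h3)
          refine hy ⟨h3, lt_of_le_of_ne h1 fun h => ?_, lt_of_le_of_ne h2 fun h => ?_⟩
          · exact h4.ne' (S.level_inner j _ h.symm)
          · exact h4.ne' (S.level_outer j _ h)
        · filter_upwards [P.eventually_shift hyp (P.f_notMem_core hyp)] with z hz hz'
          exact h3 (hz ▸ hz'.1)
      · filter_upwards [hd.continuousAt.eventually (lt_mem_nhds (not_le.1 h2))] with z hz hz'
        exact lt_asymm hz hz'.2.2
    · filter_upwards [hd.continuousAt.eventually (gt_mem_nhds (not_le.1 h1))] with z hz hz'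
      exact lt_asymm hz hz'.2.1
  · rw [isOpen_iff_mem_nhds]
    rintro y ⟨h1, h2, h3⟩
    have hyp := hne y h2.le h3.le
    filter_upwards [P.eventually_shift hyp (P.f_notMem_core hyp),
      hd.continuousAt.eventually (lt_mem_nhds h2),
      hd.continuousAt.eventually (gt_mem_nhds h3)] with z hz1 hz2 hz3
    exact ⟨hz1.trans h1, hz2, hz3⟩

/-- Otherwise part of the shift class of `x` would be a clopen set confined to one shell and missing
the pole. -/
theorem exists_rank_le_one [CompactSpace Y] {φ : Y → X} (hφ : Continuous φ)
    (hp : φ P.p ∈ S.core) {x : Y} (hx : x ≠ P.p) :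
    ∃ y, y ≠ P.p ∧ P.shift y = P.shift x ∧ S.rank (φ y) ≤ 1 := by
  by_contra! h
  obtain ⟨j, hj⟩ := S.exists_shell _ (S.half_lt_level (h x hx rfl))
  have hcl := P.isClopen_confined hφ hp j (P.shift x) h
  have huniv := hcl.eq_univ ⟨x, rfl, hj⟩
  have := huniv.symm ▸ mem_univ P.p
  exact S.notMem_core j _ this.2.1.le this.2.2.le hp

/-- The image of a point has the same rank as the point. -/
theorem rank_f [CompactSpace Y] {x : Y} (hx : x ≠ P.p) :
    S.rank (P.f x) = S.rank (P.g x) := by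
  -- Ranks are at least 1: rank 1 along `g` makes the shift nonnegative, rank 1 along `f` makes it
  -- nonpositive.
  obtain ⟨y, -, hy1, hy2⟩ := P.exists_rank_le_one P.continuous_g
    (by rw [P.g_p]; exact P.isPole.mem_core) hx
  obtain ⟨z, -, hz1, hz2⟩ := P.exists_rank_le_one P.continuous_f P.f_p_mem_core hx
  have a := S.one_le_rank (P.f y)
  have b := S.one_le_rank (P.g z)
  simp only [shift] at hy1 hz1
  omega

/-- The pole is not mapped to a point that lies inside arbitrarily small shells that are higher
than the shells around the pole. -/
theorem not_forall_exists_higher [CompactSpace Y]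
    (h : ∀ V ∈ 𝓝 (P.f P.p), ∃ j, L < S.height j ∧
      dist (P.f P.p) (S.center j) < 3 / 4 * S.radius j ∧
        closedBall (S.center j) (S.radius j) ⊆ V) : False := by
  obtain ⟨x, hx⟩ := P.exists_dist_eq
  have hxp : x ≠ P.p := by
    rintro rfl
    have := P.isPole.radius_pos
    rw [P.g_p, dist_self] at hx
    linarith
  have hne : P.f x ≠ P.f P.p := fun h' => P.f_notMem_core hxp (h' ▸ P.f_p_mem_core)
  obtain ⟨j, hjL, hj, hjV⟩ := h _ (isOpen_ne.mem_nhds hne.symm)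
  have hr := S.radius_pos j
  -- Ranks along `g`, hence along `f`, are at most `L` off the pole, so `f` avoids the middle sphere
  -- of a higher shell.
  have hpeak : ∀ y, dist (P.f y) (S.center j) ≠ 3 / 4 * S.radius j := by
    intro y hy
    have h1 := S.rank_eq_of_level_eq (S.level_peak j _ hy)
    have hyp : y ≠ P.p := by
      rintro rfl
      exact hj.ne hy
    have := P.rank_g_le hyp
    rw [← P.rank_f hyp] at this
    omega
  have hd : Continuous fun y => dist (P.f y) (S.center j) := P.continuous_f.dist continuous_const
  have hcl : IsClopen {y | dist (P.f y) (S.center j) < 3 / 4 * S.radius j} := by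
    refine ⟨?_, isOpen_lt hd continuous_const⟩
    convert isClosed_le hd (continuous_const (y := 3 / 4 * S.radius j)) using 1
    ext y
    simp only [mem_ofPred_eq]
    exact ⟨fun h => h.le, fun h => lt_of_le_of_ne h (hpeak y)⟩
  have hxj : x ∈ {y | dist (P.f y) (S.center j) < 3 / 4 * S.radius j} :=
    (hcl.eq_univ ⟨P.p, hj⟩).symm ▸ mem_univ x
  rw [mem_ofPred_eq] at hxj
  exact hjV (mem_closedBall.2 (by linarith)) rfl

/-- The pole is not mapped to a pole with lower shells. -/
theorem f_p_ne_of_lt [CompactSpace Y] {c' : X} {R' : ℝ} {L' : ℤ} (h : S.IsPole c' R' L')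
    (hL : L' < L) : P.f P.p ≠ c' := by
  intro hc'
  have h1 : ∀ᶠ y in 𝓝 P.p, dist (P.f y) c' < R' := by
    refine (P.continuous_f.dist continuous_const).continuousAt.eventually (gt_mem_nhds ?_)
    simpa [hc'] using h.radius_pos
  rw [P.isInducing_g.nhds_eq_comap, P.g_p, eventually_comap, Metric.eventually_nhds_iff] at h1
  obtain ⟨ε, hε, h1⟩ := h1
  obtain ⟨j, hc, hj, hjε, hjR⟩ := P.isPole.exists_shell ε hε
  have hr := S.radius_pos j
  -- The continuum meets middle spheres arbitrarily near the pole, so rank `L` must also occur near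
  -- `c'`.
  obtain ⟨y, hy⟩ := P.exists_dist_eq_of_le (r := 3 / 4 * S.radius j) (by positivity) (by linarith)
  have hyp : y ≠ P.p := by
    rintro rfl
    rw [P.g_p, dist_self] at hy
    linarith
  have h2 := S.rank_eq_of_level_eq (S.level_peak j (P.g y) (by rw [hc, hy]))
  have h3 := h.rank_le (P.f y) (fun h' => P.f_notMem_core hyp (h' ▸ h.mem_core))
    (h1 (by rw [hy]; linarith) y rfl).le
  rw [P.rank_f hyp, h2, hj] at h3
  omega

end Probe
end ShellSystem

/-! ### Continua that reach a given distance. -/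

/-- A point of a closed set without small relatively clopen neighbourhoods lies in a continuum that
reaches a given distance. -/
theorem exists_isConnected_reaching {X : Type*} [MetricSpace X] {C : Set X} {c : X} {r : ℝ}
    (hc : c ∈ C) (hr : 0 < r) (hcomp : IsCompact (C ∩ closedBall c r))
    (h : ∀ P ⊆ ball c r, c ∈ P → IsClosed P → ∀ O, IsOpen O → P = C ∩ O → False) :
    ∃ K ⊆ C ∩ closedBall c r, IsCompact K ∧ IsConnected K ∧ c ∈ K ∧ ∃ y ∈ K, dist y c = r := by
  have : CompactSpace ↥(C ∩ closedBall c r) := isCompact_iff_compactSpace.1 hcomp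
  let c' : ↥(C ∩ closedBall c r) := ⟨c, hc, mem_closedBall_self hr.le⟩
  refine ⟨Subtype.val '' connectedComponent c', ?_,
    isClosed_connectedComponent.isCompact.image continuous_subtype_val,
    isConnected_connectedComponent.image _ continuous_subtype_val.continuousOn,
    ⟨c', mem_connectedComponent, rfl⟩, ?_⟩
  · rintro _ ⟨y, -, rfl⟩
    exact y.2
  by_contra! hne
  have hlt : ∀ y ∈ connectedComponent c', dist (y : X) c < r := fun y hy =>
    lt_of_le_of_ne (mem_closedBall.1 y.2.2) (hne _ ⟨y, hy, rfl⟩)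
  -- In a compact Hausdorff space components are intersections of clopen sets, so by compactness one
  -- clopen set already stays in the open ball.
  rw [connectedComponent_eq_iInter_isClopen] at hlt
  have hU : IsOpen {y : ↥(C ∩ closedBall c r) | dist (y : X) c < r} :=
    isOpen_lt (continuous_subtype_val.dist continuous_const) continuous_const
  have : Nonempty { s : Set ↥(C ∩ closedBall c r) // IsClopen s ∧ c' ∈ s } :=
    ⟨⟨univ, isClopen_univ, mem_univ _⟩⟩
  obtain ⟨⟨Z, hZ, hcZ⟩, hZU⟩ := exists_subset_nhds_of_isCompact'
    (V := fun s : { s : Set ↥(C ∩ closedBall c r) // IsClopen s ∧ c' ∈ s } => s.1)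
    (fun s t => ⟨⟨s.1 ∩ t.1, s.2.1.inter t.2.1, s.2.2, t.2.2⟩, inter_subset_left,
      inter_subset_right⟩)
    (fun s => s.2.1.isClosed.isCompact) (fun s => s.2.1.isClosed)
    (fun y hy => hU.mem_nhds (hlt y hy))
  obtain ⟨O, hO, hOZ⟩ := isOpen_induced_iff.1 hZ.isOpen
  refine h (Subtype.val '' Z) ?_ ⟨c', hcZ, rfl⟩
    (hZ.isClosed.isCompact.image continuous_subtype_val).isClosed (O ∩ ball c r)
    (hO.inter isOpen_ball) ?_
  · rintro _ ⟨y, hy, rfl⟩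
    exact hZU hy
  · ext y
    constructor
    · rintro ⟨z, hz, rfl⟩
      exact ⟨z.2.1, by rw [← hOZ] at hz; exact hz, hZU hz⟩
    · rintro ⟨h1, h2, h3⟩
      refine ⟨⟨y, h1, ball_subset_closedBall h3⟩, ?_, rfl⟩
      rw [← hOZ]
      exact h2

/-- Boundary bumping: a relatively clopen neighbourhood of `c` that misses `z` would disconnect `C`.
-/
theorem IsConnected.exists_isConnected_reaching {X : Type*} [MetricSpace X] {C : Set X} {c z : X}
    {r : ℝ} (hC : IsCompact C) (hconn : IsConnected C) (hc : c ∈ C) (hz : z ∈ C) (hr : 0 < r)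
    (hzr : r < dist z c) :
    ∃ K ⊆ C ∩ closedBall c r, IsCompact K ∧ IsConnected K ∧ c ∈ K ∧ ∃ y ∈ K, dist y c = r := by
  refine _root_.exists_isConnected_reaching hc hr (hC.inter_right isClosed_closedBall) ?_
  rintro P hPb hcP hP O hO rfl
  obtain ⟨y, hy⟩ := hconn.isPreconnected O (C ∩ O)ᶜ hO hP.isOpen_compl
    (fun y hy => by by_cases h : y ∈ O <;> simp [h, hy]) ⟨c, hc, hcP.2⟩
    ⟨z, hz, fun h => (mem_ball.1 (hPb h)).not_gt hzr⟩
  exact hy.2.2 ⟨hy.1, hy.2.1⟩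

theorem HasPositiveDimension.exists_isConnected {X : Type*} [MetricSpace X]
    [LocallyCompactSpace X] (hX : HasPositiveDimension X) :
    ∃ C : Set X, IsCompact C ∧ IsConnected C ∧ C.Nontrivial := by
  simp only [HasPositiveDimension, HasDimensionZero] at hX
  push Not at hX
  obtain ⟨x, U, hU, hxU, hV⟩ := hX
  obtain ⟨N, hN, hNU, hNc⟩ := local_compact_nhds (hU.mem_nhds hxU)
  obtain ⟨r, hr, hrN⟩ := nhds_basis_closedBall.mem_iff.1 hN
  obtain ⟨K, -, hK, hKc, hxK, y, hy, hyr⟩ := exists_isConnected_reaching (C := univ) (mem_univ x) hr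
    (by rw [univ_inter]; exact hNc.of_isClosed_subset isClosed_closedBall hrN) (by
      rintro P hPb hxP hP O hO rfl
      rw [univ_inter] at *
      exact hV O ((hPb.trans ball_subset_closedBall).trans (hrN.trans hNU)) hxP ⟨hP, hO⟩)
  refine ⟨K, hK, hKc, x, hxK, y, hy, ?_⟩
  rintro rfl
  rw [dist_self] at hyr
  exact hr.ne hyr

/-! ### Construction of the tree of balls. -/

/-- A Cantor scheme of closed balls together with, for each node, a further ball in the same
parent ball that is disjoint from the balls of its children. -/
structure BallTree (X : Type*) [MetricSpace X] where
  point : List Bool → X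
  pole : List Bool → X
  radius : List Bool → ℝ
  poleRadius : List Bool → ℝ
  radius_pos : ∀ t, 0 < radius t
  poleRadius_pos : ∀ t, 0 < poleRadius t
  radius_le : ∀ t, radius t ≤ (1 / 2) ^ t.length
  poleRadius_le : ∀ t, poleRadius t ≤ (1 / 2) ^ (t.length + 1)
  child_subset : ∀ b t, closedBall (point (b :: t)) (radius (b :: t)) ⊆
    ball (point t) (radius t / 2)
  pole_subset : ∀ t, closedBall (pole t) (poleRadius t) ⊆ ball (point t) (radius t / 2)
  disjoint_child : ∀ b b' t, b ≠ b' → Disjoint (closedBall (point (b :: t)) (radius (b :: t)))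
    (closedBall (point (b' :: t)) (radius (b' :: t)))
  disjoint_pole : ∀ b t, Disjoint (closedBall (point (b :: t)) (radius (b :: t)))
    (closedBall (pole t) (poleRadius t))

/-- A nontrivial preconnected set has no isolated points, so three centres are available: `some b`
serves for the children and `none` for the pole. -/
theorem exists_disjoint_closedBalls {X : Type*} [MetricSpace X] {C : Set X}
    (hC : IsPreconnected C) (hC' : C.Nontrivial) {x : X} (hx : x ∈ C) {r : ℝ} (hr : 0 < r) :
    ∃ (p : Option Bool → X) (ε : ℝ), 0 < ε ∧ ε ≤ r / 2 ∧
      (∀ i, p i ∈ C ∧ closedBall (p i) ε ⊆ ball x (r / 2)) ∧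
      ∀ i j, i ≠ j → Disjoint (closedBall (p i) ε) (closedBall (p j) ε) := by
  have hinf : (ball x (r / 2) ∩ C).Infinite := Set.Infinite.of_accPt
    ((hC.preperfect_of_nontrivial hC' x hx).nhds_inter (ball_mem_nhds x (half_pos hr)))
  have := hinf.to_subtype
  let e : Option Bool → ↥(ball x (r / 2) ∩ C) := fun i =>
    Infinite.natEmbedding _ (Encodable.encode i)
  have he : Function.Injective e := (Infinite.natEmbedding _).injective.comp
    Encodable.encode_injective
  have hlim : ∀ c : ℝ, 0 < c → ∀ᶠ ε in 𝓝[>] (0 : ℝ), ε < c := fun c hc =>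
    nhdsWithin_le_nhds (gt_mem_nhds hc)
  have h1 : ∀ᶠ ε in 𝓝[>] (0 : ℝ), ∀ i, ε < r / 2 - dist (e i : X) x :=
    eventually_all.2 fun i => hlim _ (sub_pos.2 (e i).2.1)
  have h2 : ∀ᶠ ε in 𝓝[>] (0 : ℝ), ∀ i j, i ≠ j → ε < dist (e i : X) (e j) / 2 :=
    eventually_all.2 fun i => eventually_all.2 fun j => by
      by_cases hij : i = j
      · simp [hij]
      · filter_upwards [hlim _ (half_pos (dist_pos.2 (Subtype.val_injective.ne (he.ne hij))))]
          with ε hε _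
        exact hε
  obtain ⟨ε, hε1, hε2, hε3, hε0⟩ :=
    (h1.and (h2.and ((hlim _ (half_pos hr)).and self_mem_nhdsWithin))).exists
  refine ⟨fun i => e i, ε, hε0, hε3.le, fun i => ⟨(e i).2.2, ?_⟩, fun i j hij => ?_⟩
  · exact closedBall_subset_ball' (by linarith [hε1 i])
  · exact closedBall_disjoint_closedBall (by linarith [hε2 i j hij])

theorem BallTree.exists_of_isPreconnected {X : Type*} [MetricSpace X] {C : Set X}
    (hC : IsPreconnected C) (hC' : C.Nontrivial) :
    ∃ T : BallTree X, ∀ t, T.point t ∈ C ∧ T.pole t ∈ C := by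
  have hstep : ∀ q : C × Ioi (0 : ℝ), ∃ (p : Option Bool → C) (ε : Ioi (0 : ℝ)),
      (ε : ℝ) ≤ q.2 / 2 ∧ (∀ i, closedBall (p i : X) ε ⊆ ball (q.1 : X) (q.2 / 2)) ∧
      ∀ i j, i ≠ j → Disjoint (closedBall (p i : X) ε) (closedBall (p j : X) ε) := by
    rintro ⟨⟨x, hx⟩, r, hr⟩
    obtain ⟨p, ε, h1, h2, h3, h4⟩ := exists_disjoint_closedBalls hC hC' hx hr
    exact ⟨fun i => ⟨p i, (h3 i).1⟩, ⟨ε, h1⟩, h2, fun i => (h3 i).2, h4⟩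
  choose p ε h1 h2 h3 using hstep
  obtain ⟨x, hx⟩ := hC'.nonempty
  let q : List Bool → C × Ioi (0 : ℝ) := fun t =>
    t.rec (⟨x, hx⟩, ⟨1, mem_Ioi.2 one_pos⟩) fun b _ q => (p q (some b), ε q)
  have hq : ∀ b t, q (b :: t) = (p (q t) (some b), ε (q t)) := fun _ _ => rfl
  have hle : ∀ t, ((q t).2 : ℝ) ≤ (1 / 2) ^ t.length := by
    intro t
    induction t with
    | nil => simp [q]
    | cons b t ih =>
      have := h1 (q t)
      rw [hq, List.length_cons, pow_succ]
      simp only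
      linarith
  refine ⟨{ point := fun t => (q t).1
            pole := fun t => p (q t) none
            radius := fun t => (q t).2
            poleRadius := fun t => ε (q t)
            radius_pos := fun t => (q t).2.2
            poleRadius_pos := fun t => (ε (q t)).2
            radius_le := hle
            poleRadius_le := fun t => ?_
            child_subset := fun b t => h2 (q t) (some b)
            pole_subset := fun t => h2 (q t) none
            disjoint_child := fun b b' t h => h3 (q t) _ _ (by simpa using h)
            disjoint_pole := fun b t => h3 (q t) _ _ (by simp) }, fun t => ⟨(q t).1.2, ?_⟩⟩
  · have := h1 (q t)
    have := hle t
    rw [pow_succ]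
    linarith
  · exact (p (q t) none).2

/-! ### Nesting of the balls and the core. -/

namespace BallTree

variable {X : Type*} [MetricSpace X] (T : BallTree X)

/-- The centers of the balls of the tree and of the concentric balls around the poles. -/
def ctr : List Bool × ℕ → X
  | (t, 0) => T.point t
  | (t, _ + 1) => T.pole t

/-- The radii of the balls of the tree and of the concentric balls around the poles. -/
noncomputable def rad : List Bool × ℕ → ℝ
  | (t, 0) => T.radius t
  | (t, k + 1) => T.poleRadius t * (1 / 2) ^ k

/-- The height of the shell inside a ball: unbounded along the branches of the tree, and constant
around a pole, with different constants for different poles. -/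
def hgt : List Bool × ℕ → ℤ
  | (t, 0) => t.length + 5
  | (t, _ + 1) => Encodable.encode t + 5

/-- The depth of a ball. -/
def depth (p : List Bool × ℕ) : ℕ := p.1.length + p.2

/-- The ball `q` is one of the largest balls inside the inner half of the ball `p`. -/
inductive IsChild : List Bool × ℕ → List Bool × ℕ → Prop
  | node (b : Bool) (t : List Bool) : IsChild (t, 0) (b :: t, 0)
  | pole (t : List Bool) : IsChild (t, 0) (t, 1)
  | step (t : List Bool) (k : ℕ) : IsChild (t, k + 1) (t, k + 2)

/-- The closed ball with a given index. -/
noncomputable def cball (p : List Bool × ℕ) : Set X := closedBall (T.ctr p) (T.rad p)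

theorem rad_pos (p : List Bool × ℕ) : 0 < T.rad p := by
  rcases p with ⟨t, _ | k⟩
  · exact T.radius_pos t
  · exact mul_pos (T.poleRadius_pos t) (by positivity)

theorem rad_le (p : List Bool × ℕ) : T.rad p ≤ (1 / 2) ^ depth p := by
  rcases p with ⟨t, _ | k⟩
  · exact T.radius_le t
  · have h := T.poleRadius_le t
    calc T.poleRadius t * (1 / 2) ^ k ≤ (1 / 2) ^ (t.length + 1) * (1 / 2) ^ k := by gcongr
      _ = (1 / 2) ^ depth (t, k + 1) := by rw [← pow_add, depth]; congr 1; ring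

theorem IsChild.depth_eq {p q : List Bool × ℕ} (h : IsChild p q) : depth q = depth p + 1 := by
  cases h <;> (simp [depth]; try ring)

theorem exists_isChild {q : List Bool × ℕ} {n : ℕ} (hq : depth q = n + 1) :
    ∃ p, IsChild p q ∧ depth p = n := by
  obtain ⟨p, hp⟩ : ∃ p, IsChild p q := by
    rcases q with ⟨_ | ⟨b, t⟩, _ | _ | k⟩
    · simp [depth] at hq
    · exact ⟨_, .pole _⟩
    · exact ⟨_, .step _ _⟩
    · exact ⟨_, .node _ _⟩
    · exact ⟨_, .pole _⟩
    · exact ⟨_, .step _ _⟩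
  exact ⟨p, hp, by have := hp.depth_eq; omega⟩

variable {T}

/-- Around a pole the child is exactly the inner half, so its closed ball need not lie in the open
half; hence separate open and closed inclusions. -/
theorem IsChild.subset {p q : List Bool × ℕ} (h : IsChild p q) :
    ball (T.ctr q) (T.rad q) ⊆ ball (T.ctr p) (T.rad p / 2) ∧
      T.cball q ⊆ closedBall (T.ctr p) (T.rad p / 2) := by
  cases h with
  | node b t =>
    exact ⟨ball_subset_closedBall.trans (T.child_subset b t),
      (T.child_subset b t).trans ball_subset_closedBall⟩
  | pole t =>
    have h := T.pole_subset t
    simp only [cball, ctr, rad, pow_zero, mul_one]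
    exact ⟨ball_subset_closedBall.trans h, h.trans ball_subset_closedBall⟩
  | step t k =>
    have h : T.rad (t, k + 2) = T.rad (t, k + 1) / 2 := by simp only [rad, pow_succ]; ring
    simp only [cball, h, ctr]
    exact ⟨subset_rfl, subset_rfl⟩

theorem IsChild.cball_subset {p q : List Bool × ℕ} (h : IsChild p q) : T.cball q ⊆ T.cball p :=
  h.subset.2.trans (closedBall_subset_closedBall (by linarith [T.rad_pos p]))

theorem IsChild.disjoint {p q q' : List Bool × ℕ} (h : IsChild p q) (h' : IsChild p q')
    (hne : q ≠ q') : Disjoint (T.cball q) (T.cball q') := by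
  have key : ∀ b t, Disjoint (T.cball (b :: t, 0)) (T.cball (t, 1)) := by
    intro b t
    simpa only [cball, ctr, rad, pow_zero, mul_one] using T.disjoint_pole b t
  cases h with
  | node b t =>
    cases h' with
    | node b' => exact T.disjoint_child b b' t (by rintro rfl; exact hne rfl)
    | pole => exact key b t
  | pole t =>
    cases h' with
    | node b' => exact (key b' t).symm
    | pole => exact absurd rfl hne
  | step t k =>
    cases h' with
    | step => exact absurd rfl hne

theorem disjoint_of_depth_eq {p q : List Bool × ℕ} (h : depth p = depth q) (hne : p ≠ q) :
    Disjoint (T.cball p) (T.cball q) := by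
  induction hn : depth p generalizing p q with
  | zero =>
    obtain ⟨h1, h2⟩ := Nat.add_eq_zero_iff.1 hn
    obtain ⟨h3, h4⟩ := Nat.add_eq_zero_iff.1 (h.symm.trans hn)
    rw [List.length_eq_zero_iff] at h1 h3
    exact absurd (Prod.ext (h1.trans h3.symm) (h2.trans h4.symm)) hne
  | succ n ih =>
    obtain ⟨p', hp', hp'n⟩ := exists_isChild hn
    obtain ⟨q', hq', hq'n⟩ := exists_isChild (h ▸ hn)
    by_cases hpq : p' = q'
    · subst hpq
      exact hp'.disjoint hq' hne
    · exact (ih (hp'n.trans hq'n.symm) hpq hp'n).mono hp'.cball_subset hq'.cball_subset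

theorem eq_of_mem_cball {p q : List Bool × ℕ} (h : depth p = depth q) {x : X}
    (hp : x ∈ T.cball p) (hq : x ∈ T.cball q) : p = q := by
  by_contra hne
  exact (disjoint_of_depth_eq h hne).notMem_of_mem_left hp hq

theorem exists_ancestor {q : List Bool × ℕ} {n : ℕ} (h : n ≤ depth q) :
    ∃ p, depth p = n ∧ T.cball q ⊆ T.cball p := by
  obtain ⟨m, hm⟩ := Nat.exists_eq_add_of_le h
  induction m generalizing q with
  | zero => exact ⟨q, hm, subset_rfl⟩
  | succ m ih =>
    obtain ⟨p, hp, hpn⟩ := exists_isChild (q := q) (n := n + m) (by omega)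
    obtain ⟨p', hp', hsub⟩ := ih (q := p) (by omega) hpn
    exact ⟨p', hp', hp.cball_subset.trans hsub⟩

/-- Two balls are disjoint or one lies in the inner half of the other. -/
theorem trichotomy {p q : List Bool × ℕ} (h : depth p ≤ depth q) :
    p = q ∨ (ball (T.ctr q) (T.rad q) ⊆ ball (T.ctr p) (T.rad p / 2) ∧
      T.cball q ⊆ closedBall (T.ctr p) (T.rad p / 2)) ∨ Disjoint (T.cball p) (T.cball q) := by
  obtain ⟨m, hm⟩ := Nat.exists_eq_add_of_le h
  induction m generalizing q with
  | zero =>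
    by_cases hpq : p = q
    · exact Or.inl hpq
    · exact Or.inr (Or.inr (disjoint_of_depth_eq hm.symm hpq))
  | succ m ih =>
    obtain ⟨q', hq', hq'n⟩ := exists_isChild (q := q) (n := depth p + m) (by omega)
    rcases ih (q := q') (by omega) hq'n with rfl | ⟨h1, h2⟩ | h3
    · exact Or.inr (Or.inl hq'.subset)
    · refine Or.inr (Or.inl ⟨?_, ?_⟩)
      · exact (hq'.subset.1.trans (ball_subset_ball (by linarith [T.rad_pos q']))).trans h1
      · exact hq'.cball_subset.trans h2
    · exact Or.inr (Or.inr (h3.mono_right hq'.cball_subset))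

theorem not_shell_of_ne {p q : List Bool × ℕ} (hne : p ≠ q) {x : X}
    (h1 : T.rad p / 2 ≤ dist x (T.ctr p)) (h2 : dist x (T.ctr p) ≤ T.rad p) :
    ¬ (T.rad q / 2 < dist x (T.ctr q) ∧ dist x (T.ctr q) < T.rad q) := by
  rintro ⟨h3, h4⟩
  rcases le_total (depth p) (depth q) with h | h
  · rcases trichotomy (T := T) h with rfl | ⟨h5, -⟩ | h5
    · exact hne rfl
    · exact h1.not_gt (h5 (mem_ball.2 h4))
    · exact h5.notMem_of_mem_left (mem_closedBall.2 h2) (mem_closedBall.2 h4.le)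
  · rcases trichotomy (T := T) h with rfl | ⟨-, h5⟩ | h5
    · exact hne rfl
    · exact h3.not_ge (h5 (mem_closedBall.2 h2))
    · exact h5.notMem_of_mem_left (mem_closedBall.2 h4.le) (mem_closedBall.2 h2)

theorem finite_depth_le (n : ℕ) : {p : List Bool × ℕ | depth p ≤ n}.Finite := by
  refine ((List.finite_length_le Bool n).prod (Set.finite_le_nat n)).subset ?_
  rintro ⟨t, k⟩ h
  simp only [depth, mem_ofPred_eq] at h
  simp only [mem_prod, mem_ofPred_eq]
  omega

variable (T)

/-- The points that lie in balls of every depth. -/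
def core : Set X := ⋂ n, ⋃ p ∈ {p : List Bool × ℕ | depth p = n}, T.cball p

theorem isClosed_union (n : ℕ) : IsClosed (⋃ p ∈ {p : List Bool × ℕ | depth p = n}, T.cball p) :=
  ((finite_depth_le n).subset fun _ h => le_of_eq h).isClosed_biUnion fun _ _ => isClosed_closedBall

theorem isClosed_core : IsClosed T.core := isClosed_iInter T.isClosed_union

variable {T}

theorem mem_core_iff {x : X} : x ∈ T.core ↔ ∀ n, ∃ p, depth p = n ∧ x ∈ T.cball p := by
  simp [core]

theorem exists_child_of_mem_core {x : X} (hx : x ∈ T.core) {p : List Bool × ℕ}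
    (hp : x ∈ T.cball p) : ∃ q, IsChild p q ∧ x ∈ T.cball q := by
  obtain ⟨q, hq, hxq⟩ := mem_core_iff.1 hx (depth p + 1)
  obtain ⟨p', hp', hd⟩ := exists_isChild hq
  obtain rfl := eq_of_mem_cball hd (hp'.cball_subset hxq) hp
  exact ⟨q, hp', hxq⟩

/-- One generation only puts a core point in the closed inner half; passing to a grandchild makes
the inequality strict. -/
theorem notMem_core {p : List Bool × ℕ} {x : X} (h1 : T.rad p / 2 ≤ dist x (T.ctr p))
    (h2 : dist x (T.ctr p) ≤ T.rad p) : x ∉ T.core := by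
  intro hx
  obtain ⟨q, hq, hxq⟩ := exists_child_of_mem_core hx (mem_closedBall.2 h2)
  obtain ⟨q', hq', hxq'⟩ := exists_child_of_mem_core hx hxq
  have h3 := hq.subset.1 (closedBall_subset_ball (by linarith [T.rad_pos q]) (hq'.subset.2 hxq'))
  exact h1.not_gt h3

theorem mem_core_of_forall {x : X} (h : ∀ n, ∃ p, n ≤ depth p ∧ x ∈ T.cball p) : x ∈ T.core := by
  refine mem_core_iff.2 fun n => ?_
  obtain ⟨p, hp, hx⟩ := h n
  obtain ⟨p', hp', hsub⟩ := exists_ancestor (T := T) hp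
  exact ⟨p', hp', hsub hx⟩

variable (T)

/-! ### The level function and the shell system of a tree. -/

/-- The tent over a shell. -/
noncomputable def tent (p : List Bool × ℕ) (x : X) : ℝ :=
  ((hgt p : ℝ) - 1 / 2) * max 0 (1 - 4 * |dist x (T.ctr p) / T.rad p - 3 / 4|)

/-- The level function of the shells. -/
noncomputable def level (x : X) : ℝ := 1 / 2 + ∑ᶠ p, T.tent p x

variable {T}

theorem five_le_hgt (p : List Bool × ℕ) : 5 ≤ hgt p := by
  rcases p with ⟨t, _ | k⟩ <;> simp [hgt]

theorem five_le_hgt_real (p : List Bool × ℕ) : (5 : ℝ) ≤ hgt p := by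
  exact_mod_cast five_le_hgt p

theorem tent_nonneg (p : List Bool × ℕ) (x : X) : 0 ≤ T.tent p x :=
  mul_nonneg (by linarith [five_le_hgt_real p]) (le_max_left _ _)

theorem tent_le (p : List Bool × ℕ) (x : X) : T.tent p x ≤ hgt p - 1 / 2 := by
  refine mul_le_of_le_one_right (by linarith [five_le_hgt_real p]) (max_le zero_le_one ?_)
  linarith [abs_nonneg (dist x (T.ctr p) / T.rad p - 3 / 4)]

theorem continuous_tent (p : List Bool × ℕ) : Continuous (T.tent p) := by
  unfold tent
  fun_prop

theorem shell_of_tent_ne_zero {p : List Bool × ℕ} {x : X} (h : T.tent p x ≠ 0) :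
    T.rad p / 2 < dist x (T.ctr p) ∧ dist x (T.ctr p) < T.rad p := by
  have hr := T.rad_pos p
  have h1 : 0 < 1 - 4 * |dist x (T.ctr p) / T.rad p - 3 / 4| := by
    by_contra h'
    exact h (by rw [tent, max_eq_left (not_lt.1 h'), mul_zero])
  have h2 : |dist x (T.ctr p) / T.rad p - 3 / 4| < 1 / 4 := by linarith
  rw [abs_lt] at h2
  constructor
  · rw [← div_lt_div_iff_of_pos_right hr, div_right_comm, div_self hr.ne']
    linarith [h2.1]
  · rw [← div_lt_one hr]
    linarith [h2.2]

theorem level_eq {p : List Bool × ℕ} {x : X} (h1 : T.rad p / 2 ≤ dist x (T.ctr p))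
    (h2 : dist x (T.ctr p) ≤ T.rad p) : T.level x = 1 / 2 + T.tent p x := by
  rw [level, finsum_eq_single _ p]
  intro q hq
  by_contra h
  exact not_shell_of_ne hq.symm h1 h2 (shell_of_tent_ne_zero h)

/-- Off the core, the balls of some depth `n` miss a whole neighbourhood, where only finitely many
tents survive. -/
theorem continuousAt_level {x : X} (hx : x ∉ T.core) : ContinuousAt T.level x := by
  obtain ⟨n, hn⟩ : ∃ n, x ∉ ⋃ p ∈ {p : List Bool × ℕ | depth p = n}, T.cball p := by
    simpa only [core, mem_iInter, not_forall] using hx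
  have hev : T.level =ᶠ[𝓝 x] fun y => 1 / 2 + ∑ p ∈ (finite_depth_le n).toFinset, T.tent p y := by
    filter_upwards [(T.isClosed_union n).isOpen_compl.mem_nhds hn] with y hy
    rw [level, finsum_eq_sum_of_support_subset]
    intro p hp
    have hsh := shell_of_tent_ne_zero hp
    rw [Finite.coe_toFinset, mem_ofPred_eq]
    by_contra! hlt
    obtain ⟨q, hq, hsub⟩ := exists_ancestor (T := T) hlt.le
    exact hy (mem_biUnion hq (hsub (mem_closedBall.2 hsh.2.le)))
  refine ContinuousAt.congr_of_eventuallyEq ?_ hev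
  exact (continuous_const.add (continuous_finsetSum _ fun p _ => continuous_tent p)).continuousAt

variable (T)

/-- The shells in the balls of a tree form a shell system. -/
noncomputable def shellSystem : ShellSystem X where
  Index := List Bool × ℕ
  center := T.ctr
  radius := T.rad
  height := hgt
  core := T.core
  level := T.level
  radius_pos := T.rad_pos
  five_le_height := five_le_hgt
  isClosed_core := T.isClosed_core
  continuousAt_level := fun _ => continuousAt_level
  half_le_level := fun x => le_add_of_nonneg_right (finsum_nonneg fun p => tent_nonneg p x)
  level_peak := fun p x h => by
    have hr := T.rad_pos p
    rw [level_eq (p := p) (by linarith) (by linarith), tent, h, mul_div_cancel_right₀ _ hr.ne']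
    norm_num
  level_outer := fun p x h => by
    have hr := T.rad_pos p
    rw [level_eq (p := p) (by linarith) h.le, tent, h, div_self hr.ne']
    norm_num [abs_of_pos]
  level_inner := fun p x h => by
    have hr := T.rad_pos p
    rw [level_eq (p := p) h.ge (by linarith), tent, h, div_right_comm, div_self hr.ne']
    norm_num [abs_of_neg]
  notMem_core := fun _ _ => notMem_core
  exists_shell := fun x hx => by
    obtain ⟨p, hp⟩ : ∃ p, T.tent p x ≠ 0 := by
      by_contra! h
      simp [level, h] at hx
    exact ⟨p, shell_of_tent_ne_zero hp⟩
  exists_small := fun b hb V hV => by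
    obtain ⟨ε, hε, hεV⟩ := nhds_basis_ball.mem_iff.1 hV
    obtain ⟨n, hn⟩ := exists_pow_lt_of_lt_one (half_pos hε) (by norm_num : (1 / 2 : ℝ) < 1)
    obtain ⟨p, hp, hbp⟩ := mem_core_iff.1 hb n
    obtain ⟨q, hq, hbq⟩ := exists_child_of_mem_core hb hbp
    have h1 := mem_closedBall.1 (hq.subset.2 hbq)
    have hr := T.rad_pos p
    have hle := T.rad_le p
    rw [hp] at hle
    refine ⟨p, by linarith, fun y hy => hεV ?_⟩
    have h2 := dist_triangle_right y b (T.ctr p)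
    have h3 := mem_closedBall.1 hy
    exact mem_ball.2 (by linarith)

variable {T}

theorem pole_mem_core (t : List Bool) : T.pole t ∈ T.core :=
  mem_core_of_forall fun n => ⟨(t, n + 1), by simp [depth]; omega,
    mem_closedBall_self (T.rad_pos (t, n + 1)).le⟩

/-- Consecutive shells around a pole share a sphere, so the closed shells cover the punctured ball.
-/
theorem isPole (t : List Bool) :
    T.shellSystem.IsPole (T.pole t) (T.poleRadius t) (Encodable.encode t + 5) := by
  have hR := T.poleRadius_pos t
  have key : ∀ x, x ≠ T.pole t → dist x (T.pole t) ≤ T.poleRadius t →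
      ∃ k, T.rad (t, k + 1) / 2 ≤ dist x (T.ctr (t, k + 1)) ∧
        dist x (T.ctr (t, k + 1)) ≤ T.rad (t, k + 1) := by
    intro x hx hxR
    obtain ⟨k, hk1, hk2⟩ := exists_nat_pow_near_of_lt_one (div_pos (dist_pos.2 hx) hR)
      ((div_le_one hR).2 hxR) (by norm_num : (0 : ℝ) < 1 / 2) (by norm_num)
    rw [lt_div_iff₀ hR] at hk1
    rw [div_le_iff₀ hR] at hk2
    refine ⟨k, ?_, ?_⟩ <;> simp only [rad, ctr]
    · rw [pow_succ] at hk1; linarith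
    · linarith
  refine ⟨pole_mem_core t, hR, fun x hx hxR => ?_, fun x hx hxR => ?_, fun ε hε => ?_⟩
  · obtain ⟨k, h1, h2⟩ := key x hx hxR
    exact notMem_core h1 h2
  · obtain ⟨k, h1, h2⟩ := key x hx hxR
    refine Int.ceil_le.2 ?_
    have h3 := tent_le (T := T) (t, k + 1) x
    have h4 : T.shellSystem.level x = _ := level_eq h1 h2
    rw [h4]
    simp only [hgt] at h3
    linarith
  · obtain ⟨k, hk⟩ := exists_pow_lt_of_lt_one (div_pos hε hR) (by norm_num : (1 / 2 : ℝ) < 1)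
    rw [lt_div_iff₀ hR] at hk
    refine ⟨(t, k + 2), rfl, rfl, ?_, ?_⟩
    · change T.poleRadius t * (1 / 2) ^ (k + 1) < ε
      rw [pow_succ]
      have : 0 < (1 / 2 : ℝ) ^ k * T.poleRadius t := by positivity
      linarith
    · change T.poleRadius t * (1 / 2) ^ (k + 1) < T.poleRadius t
      exact mul_lt_of_lt_one_right hR (pow_lt_one₀ (by norm_num) (by norm_num) (by omega))

/-- A point of the core is a pole or lies inside arbitrarily small and high shells. -/
theorem eq_pole_or_exists_higher {b : X} (hb : b ∈ T.core) :
    (∃ t, b = T.pole t) ∨ ∀ N : ℤ, ∀ V ∈ 𝓝 b, ∃ p, N < hgt p ∧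
      dist b (T.ctr p) < 3 / 4 * T.rad p ∧ closedBall (T.ctr p) (T.rad p) ⊆ V := by
  by_cases h : ∃ t k, b ∈ T.cball (t, k + 1)
  · left
    obtain ⟨t, k, hk⟩ := h
    have hall : ∀ m, b ∈ T.cball (t, k + m + 1) := by
      intro m
      induction m with
      | zero => exact hk
      | succ m ih =>
        obtain ⟨q, hq, hbq⟩ := exists_child_of_mem_core hb ih
        cases hq
        exact hbq
    refine ⟨t, dist_le_zero.1 (le_of_forall_pos_lt_add fun ε hε => ?_)⟩
    obtain ⟨n, hn⟩ := exists_pow_lt_of_lt_one hε (by norm_num : (1 / 2 : ℝ) < 1)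
    have h1 : dist b (T.pole t) ≤ T.rad (t, k + n + 1) := mem_closedBall.1 (hall n)
    have h2 := T.rad_le (t, k + n + 1)
    have h3 : (1 / 2 : ℝ) ^ depth (t, k + n + 1) ≤ (1 / 2) ^ n :=
      pow_le_pow_of_le_one (by norm_num) (by norm_num) (by simp [depth]; omega)
    linarith
  · right
    push Not at h
    intro N V hV
    obtain ⟨ε, hε, hεV⟩ := nhds_basis_ball.mem_iff.1 hV
    obtain ⟨n, hn⟩ := exists_pow_lt_of_lt_one (half_pos hε) (by norm_num : (1 / 2 : ℝ) < 1)
    -- Depth `n` makes the ball small; the extra `N.toNat` makes the height exceed `N`.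
    obtain ⟨⟨t, k⟩, hp, hbp⟩ := mem_core_iff.1 hb (n + N.toNat)
    obtain ⟨q, hq, hbq⟩ := exists_child_of_mem_core hb hbp
    obtain rfl : k = 0 := by
      rcases k with _ | k
      · rfl
      · exact absurd hbp (h t k)
    have h1 := mem_closedBall.1 (hq.subset.2 hbq)
    have hr := T.rad_pos (t, 0)
    have hle := T.rad_le (t, 0)
    rw [hp] at hle
    have h3 : (1 / 2 : ℝ) ^ (n + N.toNat) ≤ (1 / 2) ^ n :=
      pow_le_pow_of_le_one (by norm_num) (by norm_num) (by omega)
    refine ⟨(t, 0), ?_, by linarith, fun y hy => hεV ?_⟩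
    · simp only [depth] at hp
      simp only [hgt]
      omega
    · have h2 := dist_triangle_right y b (T.ctr (t, 0))
      have h4 := mem_closedBall.1 hy
      exact mem_ball.2 (by linarith)

end BallTree

/-! ### Reductions fix the poles; branch limits. -/

namespace BallTree

variable {X : Type*} [MetricSpace X] {T : BallTree X} {C : Set X}

/-- A map of the space that pulls back sets with the prescribed ranks off the core to each other
fixes the poles. -/
theorem map_pole (hC : IsCompact C) (hconn : IsConnected C)
    (hTC : ∀ t, T.point t ∈ C ∧ T.pole t ∈ C) {A B : Set X}
    (hA : ∀ x ∉ T.core, x ∈ A ↔ Even (T.shellSystem.rank x))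
    (hB : ∀ x ∉ T.core, x ∈ B ↔ Even (T.shellSystem.rank x)) {f : X → X} (hf : Continuous f)
    (hAB : A = f ⁻¹' B) (t : List Bool) : f (T.pole t) = T.pole t := by
  have hdist : T.poleRadius t < dist (T.point (true :: t)) (T.pole t) := by
    have := (T.disjoint_pole true t).notMem_of_mem_left
      (mem_closedBall_self (T.radius_pos (true :: t)).le)
    simpa using this
  -- The centre of a child ball is a point of `C` outside the ball of the pole, so `C` leaves that
  -- ball.
  obtain ⟨K, hK, hKc, hKconn, hcK, z, hzK, hz⟩ := hconn.exists_isConnected_reaching hC (hTC t).2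
    (hTC (true :: t)).1 (T.poleRadius_pos t) hdist
  have : CompactSpace K := isCompact_iff_compactSpace.1 hKc
  have : PreconnectedSpace K := isPreconnected_iff_preconnectedSpace.1 hKconn.isPreconnected
  let P : ShellSystem.Probe T.shellSystem (T.pole t) (T.poleRadius t) (Encodable.encode t + 5) K :=
    { isPole := isPole t
      g := Subtype.val
      f := fun y => f y
      p := ⟨T.pole t, hcK⟩
      isInducing_g := IsInducing.subtypeVal
      continuous_f := hf.comp continuous_subtype_val
      g_p := rfl
      g_ne := fun y hy h => hy (Subtype.ext h)
      dist_le := fun y => (hK y.2).2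
      exists_dist_eq := ⟨⟨z, hzK⟩, hz⟩
      source := A
      target := B
      mem_source := hA
      mem_target := hB
      mem_iff := fun y => by rw [hAB]; rfl }
  rcases eq_pole_or_exists_higher (T := T) P.f_p_mem_core with ⟨t', ht'⟩ | h
  · rcases lt_trichotomy (Encodable.encode t') (Encodable.encode t) with hlt | heq | hgt
    · exact absurd ht' (P.f_p_ne_of_lt (isPole t') (by omega))
    · rw [Encodable.encode_injective heq] at ht'
      exact ht'
    -- A pole with a larger code is itself surrounded by small shells higher than those around
    -- `T.pole t`.
    · refine (P.not_forall_exists_higher fun V hV => ?_).elim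
      rw [ht'] at hV ⊢
      obtain ⟨ε, hε, hεV⟩ := nhds_basis_closedBall.mem_iff.1 hV
      obtain ⟨p, hp, hph, hpε, -⟩ := (isPole (T := T) t').exists_shell ε hε
      refine ⟨p, by rw [hph]; omega, ?_, ?_⟩
      · rw [hp, dist_self]
        linarith [T.shellSystem.radius_pos p]
      · rw [hp]
        exact (closedBall_subset_closedBall hpε.le).trans hεV
  · exact (P.not_forall_exists_higher fun V hV => h _ V hV).elim

/-- The limits of the branches of a tree of balls with centers in a compact set. -/
theorem exists_branch_limit (hC : IsCompact C) (hTC : ∀ t, T.point t ∈ C) :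
    ∃ h : (ℕ → Bool) → X, IsClosedEmbedding h ∧
      ∀ a n, h a ∈ T.cball (PiNat.res a n, 0) := by
  have hne : ∀ a : ℕ → Bool, (⋂ n, C ∩ T.cball (PiNat.res a n, 0)).Nonempty := fun a =>
    IsCompact.nonempty_iInter_of_sequence_nonempty_isCompact_isClosed _
      (fun n => inter_subset_inter_right _ (by
        -- `PiNat.res` puts the latest coordinate first, matching the children `b :: t`.
        rw [Nat.add_one, PiNat.res_succ]
        exact (IsChild.node _ _).cball_subset))
      (fun n => ⟨T.point (PiNat.res a n), hTC _, mem_closedBall_self (T.radius_pos _).le⟩)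
      (hC.inter_right isClosed_closedBall)
      (fun n => (hC.inter_right isClosed_closedBall).isClosed)
  choose h hh using hne
  have hmem : ∀ a n, h a ∈ T.cball (PiNat.res a n, 0) := fun a n => (mem_iInter.1 (hh a) n).2
  refine ⟨h, Continuous.isClosedEmbedding ?_ ?_, hmem⟩
  · refine continuous_iff_continuousAt.2 fun a => Metric.tendsto_nhds.2 fun ε hε => ?_
    obtain ⟨n, hn⟩ := exists_pow_lt_of_lt_one (half_pos hε) (by norm_num : (1 / 2 : ℝ) < 1)
    filter_upwards [(PiNat.isOpen_cylinder (fun _ => Bool) a n).mem_nhds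
      (PiNat.self_mem_cylinder a n)] with b hb
    rw [PiNat.cylinder_eq_res] at hb
    have h1 := hmem b n
    rw [hb] at h1
    have h2 := T.rad_le (PiNat.res a n, 0)
    simp only [depth, PiNat.res_length, add_zero] at h2
    have h3 := dist_triangle_right (h b) (h a) (T.ctr (PiNat.res a n, 0))
    have h4 := mem_closedBall.1 h1
    have h5 := mem_closedBall.1 (hmem a n)
    linarith
  · intro a b hab
    refine PiNat.res_injective (funext fun n => ?_)
    have := eq_of_mem_cball (T := T) (by simp [depth]) (hmem a n) (hab ▸ hmem b n)
    exact congrArg Prod.fst this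

theorem tendsto_pole {a : ℕ → Bool} {x : X} (hx : ∀ n, x ∈ T.cball (PiNat.res a n, 0)) :
    Tendsto (fun n => T.pole (PiNat.res a n)) atTop (𝓝 x) := by
  refine tendsto_iff_dist_tendsto_zero.2 (squeeze_zero (fun _ => dist_nonneg)
    (g := fun n => 2 * (1 / 2 : ℝ) ^ n) (fun n => ?_) ?_)
  · have h1 := mem_closedBall.1 (hx n)
    have h2 := mem_ball.1 (T.pole_subset (PiNat.res a n)
      (mem_closedBall_self (T.poleRadius_pos _).le))
    have h3 := T.rad_le (PiNat.res a n, 0)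
    simp only [depth, PiNat.res_length, add_zero, rad, ctr] at h1 h3
    have h4 := dist_triangle_right (T.pole (PiNat.res a n)) x (T.point (PiNat.res a n))
    have h5 := T.radius_pos (PiNat.res a n)
    linarith
  · simpa using (tendsto_pow_atTop_nhds_zero_of_lt_one (r := (1 / 2 : ℝ)) (by norm_num)
      (by norm_num)).const_mul 2

end BallTree

/-! ### Borel definability and the main theorem. -/

theorem ShellSystem.measurableSet_even {X : Type*} [MetricSpace X] (S : ShellSystem X) :
    @MeasurableSet X (borel X) {x | x ∉ S.core ∧ Even (S.rank x)} := by
  borelize X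
  have hcont : ContinuousOn S.level S.coreᶜ := fun x hx =>
    (S.continuousAt_level x hx).continuousWithinAt
  have hopen : ∀ r : ℝ, MeasurableSet (S.coreᶜ ∩ S.level ⁻¹' Ioi r) := fun r =>
    (hcont.isOpen_inter_preimage S.isClosed_core.isOpen_compl isOpen_Ioi).measurableSet
  -- Rank `n` means `n - 1 < level ≤ n`, which off the core is a difference of two open sets.
  have : {x | x ∉ S.core ∧ Even (S.rank x)} = ⋃ n ∈ {n : ℤ | Even n},
      (S.coreᶜ ∩ S.level ⁻¹' Ioi ((n : ℝ) - 1)) \ (S.coreᶜ ∩ S.level ⁻¹' Ioi (n : ℝ)) := by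
    ext x
    simp only [mem_ofPred_eq, mem_iUnion, Set.mem_sdiff, mem_inter_iff, mem_compl_iff, mem_preimage,
      mem_Ioi, exists_prop, not_and, not_lt]
    constructor
    · rintro ⟨h1, h2⟩
      refine ⟨_, h2, ⟨h1, ?_⟩, fun _ => Int.le_ceil _⟩
      have := Int.ceil_lt_add_one (S.level x)
      simp only [rank]
      linarith
    · rintro ⟨n, hn, ⟨h1, h2⟩, h3⟩
      refine ⟨h1, ?_⟩
      rwa [rank, Int.ceil_eq_iff.2 ⟨h2, h3 h1⟩]
  rw [this]
  exact .biUnion (Set.to_countable _) fun n _ => (hopen _).diff (hopen _)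

theorem theorem3 {X : Type*} [MetricSpace X] [LocallyCompactSpace X]
    (hX : HasPositiveDimension X) :
    ∃ Φ : Set (ℕ → Bool) → Set X,
      IsExplicitlyDefinable Φ ∧ Function.Injective Φ ∧
        ∀ I J : Set (ℕ → Bool), I ≠ J → ContinuouslyIncomparable (Φ I) (Φ J) := by
  obtain ⟨C, hC, hconn, hnt⟩ := hX.exists_isConnected
  obtain ⟨T, hTC⟩ := BallTree.exists_of_isPreconnected hconn.isPreconnected hnt
  obtain ⟨h, hemb, hmem⟩ := BallTree.exists_branch_limit hC fun t => (hTC t).1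
  have hcore : ∀ a, h a ∈ T.core := fun a => BallTree.mem_core_of_forall fun n =>
    ⟨_, by simp [BallTree.depth], hmem a n⟩
  set D : Set X := {x | x ∉ T.core ∧ Even (T.shellSystem.rank x)} with hD
  have hhD : ∀ (I : Set (ℕ → Bool)) a, h a ∈ h '' I ∪ D ↔ a ∈ I := by
    intro I a
    constructor
    · rintro (⟨b, hb, hba⟩ | hd)
      · rwa [← hemb.injective hba]
      · exact absurd (hcore a) hd.1
    · exact fun ha => Or.inl ⟨a, ha, rfl⟩
  have hrank : ∀ (I : Set (ℕ → Bool)), ∀ x ∉ T.core,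
      x ∈ h '' I ∪ D ↔ Even (T.shellSystem.rank x) := by
    intro I x hx
    constructor
    · rintro (⟨b, -, rfl⟩ | hd)
      · exact absurd (hcore b) hx
      · exact hd.2
    · exact fun he => Or.inr ⟨hx, he⟩
  have hred : ∀ I J : Set (ℕ → Bool),
      ContinuouslyReducible (h '' I ∪ D) (h '' J ∪ D) → I = J := by
    rintro I J ⟨f, hf, hIJ⟩
    have hpole := BallTree.map_pole hC hconn hTC (hrank I) (hrank J) hf hIJ
    ext a
    have hlim := BallTree.tendsto_pole (hmem a)
    have hfix : f (h a) = h a := tendsto_nhds_unique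
      ((hf.tendsto (h a)).comp hlim) (by simpa only [Function.comp_def, hpole] using hlim)
    rw [← hhD I a, hIJ, mem_preimage, hfix, hhD]
  refine ⟨fun I => h '' I ∪ D, ⟨h, D, hemb, T.shellSystem.measurableSet_even, ?_, fun _ => rfl⟩,
    fun I J hIJ => ?_, fun I J hne hor => ?_⟩
  · rw [Set.disjoint_left]
    rintro _ ⟨a, rfl⟩ hd
    exact hd.1 (hcore a)
  · exact hred I J ⟨id, continuous_id, hIJ⟩
  · rcases hor with h' | h'
    · exact hne (hred I J h')
    · exact hne (hred J I h').symm
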